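/- Let $G$ be a finite simple undirected graph with two vertices $s,t$. An \emph{$s$-$t$-separator} is a set $S\subseteq V(G)\setminus\{s,t\}$ such that $s$ and $t$ lie in different connected components of $G-S$; it is \emph{minimum} if it has the smallest size among all $s$-$t$-separators. A \emph{token jump} replaces a set $S$ by $(S\setminus\{v\})\cup\{u\}$ with $v\in S$ and $u\in V(G)\setminus S$. A minimum $s$-$t$-separator $A$ \emph{can be reconfigured} into a minimum $s$-$t$-separator $B$ by token jumps if there is a sequence $A=S_0,S_1,\dots,S_\ell=B$ with $\ell\ge 0$ in which every $S_i$ is a minimum $s$-$t$-separator and every $S_{i+1}$ arises from $S_i$ by one token jump. \textbf{Theorem.} There is a polynomial-time algorithm (a fixed program of a unit-cost random access machine with addition, subtraction and indirect addressing, whose number of steps is bounded by a polynomial in $n=|V(G)|$) that, given a graph $G$ on the vertex set $\{0,\dots,n-1\}$, vertices $s,t$, and two minimum $s$-$t$-separators $A$ and $B$, decides whether $A$ can be reconfigured into $B$ by token jumps and, if it can, outputs a (not necessarily shortest) sequence of token jumps $(v_0,u_0),\dots,(v_{\ell-1},u_{\ell-1})$ that reconfigures $A$ into $B$ through minimum $s$-$t$-separators.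 -/

import Mathlib

/-! ## Minimum separators and token jumps -/

/-- `S` is an `s`-`t`-separator of `G`: the vertices `s` and `t` both survive in `G - S` and lie in
different connected components of `G - S`. -/
def IsSeparator {V : Type*} (G : SimpleGraph V) (s t : V) (S : Finset V) : Prop :=
  ∃ (hs : s ∈ ((S : Set V)ᶜ)) (ht : t ∈ ((S : Set V)ᶜ)),
    ¬ (G.induce ((S : Set V)ᶜ)).Reachable ⟨s, hs⟩ ⟨t, ht⟩

/-- `S` is an `s`-`t`-separator of minimum size. -/
def IsMinSeparator {V : Type*} (G : SimpleGraph V) (s t : V) (S : Finset V) : Prop :=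
  IsSeparator G s t S ∧ ∀ S' : Finset V, IsSeparator G s t S' → S.card ≤ S'.card

/-- `S'` arises from `S` by letting the token on `v ∈ S` jump to the vertex `u ∉ S`. -/
def IsTokenJump {V : Type*} [DecidableEq V] (S : Finset V) (v u : V) (S' : Finset V) : Prop :=
  v ∈ S ∧ u ∉ S ∧ S' = (S \ {v}) ∪ {u}

/-- `S 0, S 1, …, S l` is a token jumping reconfiguration sequence, with `l` jumps, from `A` to `B`:
all its members are minimum `s`-`t`-separators and each one arises from the previous one by one
token jump (the values `S i` for `i > l` are irrelevant). -/
def IsJumpSequence {V : Type*} [DecidableEq V] (G : SimpleGraph V) (s t : V) (A B : Finset V)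
    (l : ℕ) (S : ℕ → Finset V) : Prop :=
  S 0 = A ∧ S l = B ∧ (∀ i ≤ l, IsMinSeparator G s t (S i)) ∧
    ∀ i < l, ∃ v u : V, IsTokenJump (S i) v u (S (i + 1))

/-- `A` can be reconfigured into `B` by token jumps. -/
def JumpReconfigurable {V : Type*} [DecidableEq V] (G : SimpleGraph V) (s t : V)
    (A B : Finset V) : Prop :=
  ∃ (l : ℕ) (S : ℕ → Finset V), IsJumpSequence G s t A B l S

/-! ## Random access machines

The machine has registers and arrays of unbounded length, all holding natural numbers. A program is
a fixed finite text, so it names only finitely many registers and arrays. Its arithmetic consists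
of addition and truncated subtraction only; under the unit-cost measure, this model is polynomially
equivalent to Turing machines. -/

namespace RAM

/-- A memory state: register `i` holds `reg i`, cell `j` of array `a` holds `arr a j`. -/
@[ext]
structure State where
  reg : ℕ → ℕ
  arr : ℕ → ℕ → ℕ

/-- Expressions: constants, registers, array cells with a computed index, sums and truncated
differences. -/
inductive Expr : Type
  | const (c : ℕ) : Expr
  | reg (i : ℕ) : Expr
  | load (a : ℕ) (e : Expr) : Expr
  | add (e f : Expr) : Expr
  | sub (e f : Expr) : Expr

/-- The value of an expression in a memory state. -/
def Expr.eval (m : State) : Expr → ℕ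
  | .const c => c
  | .reg i => m.reg i
  | .load a e => m.arr a (e.eval m)
  | .add e f => e.eval m + f.eval m
  | .sub e f => e.eval m - f.eval m

/-- The number of elementary operations that the evaluation of an expression takes. -/
def Expr.cost : Expr → ℕ
  | .const _ => 1
  | .reg _ => 1
  | .load _ e => e.cost + 1
  | .add e f => e.cost + f.cost + 1
  | .sub e f => e.cost + f.cost + 1

/-- Programs. A test expression counts as true when its value is not `0`. -/
inductive Program : Type
  | skip : Program
  | assign (i : ℕ) (e : Expr) : Program
  | store (a : ℕ) (e f : Expr) : Program
  | seq (P Q : Program) : Program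
  | branch (e : Expr) (P Q : Program) : Program
  | loop (e : Expr) (P : Program) : Program

/-- Write the number `x` into register `i`. -/
def State.setReg (m : State) (i x : ℕ) : State :=
  { m with reg := Function.update m.reg i x }

/-- Write the number `x` into cell `j` of array `a`. -/
def State.setArr (m : State) (a j x : ℕ) : State :=
  { m with arr := Function.update m.arr a (Function.update (m.arr a) j x) }

/-- `Run P m T m'`: the program `P`, started in the memory state `m`, halts after exactly `T` steps
in the memory state `m'`. `assign i e` writes `e` into register `i`, `store a e f` writes `f` into
cell `e` of array `a`, `branch e P Q` is "if `e` then `P` else `Q`", and `loop e P` is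
"while `e` do `P`". -/
inductive Run : Program → State → ℕ → State → Prop
  | skip (m : State) : Run .skip m 1 m
  | assign (m : State) (i : ℕ) (e : Expr) :
      Run (.assign i e) m (e.cost + 1) (m.setReg i (e.eval m))
  | store (m : State) (a : ℕ) (e f : Expr) :
      Run (.store a e f) m (e.cost + f.cost + 1) (m.setArr a (e.eval m) (f.eval m))
  | seq {P Q : Program} {m₁ m₂ m₃ : State} {T₁ T₂ : ℕ} :
      Run P m₁ T₁ m₂ → Run Q m₂ T₂ m₃ → Run (.seq P Q) m₁ (T₁ + T₂) m₃
  | branch_true {e : Expr} {P Q : Program} {m m' : State} {T : ℕ} :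
      e.eval m ≠ 0 → Run P m T m' → Run (.branch e P Q) m (e.cost + 1 + T) m'
  | branch_false {e : Expr} {P Q : Program} {m m' : State} {T : ℕ} :
      e.eval m = 0 → Run Q m T m' → Run (.branch e P Q) m (e.cost + 1 + T) m'
  | loop_true {e : Expr} {P : Program} {m₁ m₂ m₃ : State} {T₁ T₂ : ℕ} :
      e.eval m₁ ≠ 0 → Run P m₁ T₁ m₂ → Run (.loop e P) m₂ T₂ m₃ →
        Run (.loop e P) m₁ (e.cost + 1 + T₁ + T₂) m₃
  | loop_false {e : Expr} {P : Program} {m : State} :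
      e.eval m = 0 → Run (.loop e P) m (e.cost + 1) m

/-- Programs are deterministic: number of steps and final state are determined by the initial
state. -/
theorem Run.deterministic {P : Program} {m m₁ m₂ : State} {T₁ T₂ : ℕ}
    (h₁ : Run P m T₁ m₁) (h₂ : Run P m T₂ m₂) : T₁ = T₂ ∧ m₁ = m₂ := by
  induction h₁ generalizing T₂ m₂ with
  | skip m => cases h₂; exact ⟨rfl, rfl⟩
  | assign m i e => cases h₂; exact ⟨rfl, rfl⟩
  | store m a e f => cases h₂; exact ⟨rfl, rfl⟩
  | seq _ _ ih₁ ih₂ =>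
    cases h₂ with
    | seq a b =>
      obtain ⟨rfl, rfl⟩ := ih₁ a
      obtain ⟨rfl, rfl⟩ := ih₂ b
      exact ⟨rfl, rfl⟩
  | branch_true h _ ih =>
    cases h₂ with
    | branch_true _ a => obtain ⟨rfl, rfl⟩ := ih a; exact ⟨rfl, rfl⟩
    | branch_false h' _ => exact absurd h' h
  | branch_false h _ ih =>
    cases h₂ with
    | branch_true h' _ => exact absurd h h'
    | branch_false _ a => obtain ⟨rfl, rfl⟩ := ih a; exact ⟨rfl, rfl⟩
  | loop_true h _ _ ih₁ ih₂ =>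
    cases h₂ with
    | loop_true _ a b =>
      obtain ⟨rfl, rfl⟩ := ih₁ a
      obtain ⟨rfl, rfl⟩ := ih₂ b
      exact ⟨rfl, rfl⟩
    | loop_false h' => exact absurd h' h
  | loop_false h =>
    cases h₂ with
    | loop_true h' _ _ => exact absurd h h'
    | loop_false _ => exact ⟨rfl, rfl⟩

end RAM

/-! ## Instances and answers as memory states -/

open scoped Classical in
/-- The instance `(G, s, t, A, B)` as an initial memory state: registers `0`, `1`, `2` hold `n`, `s`
and `t`, array `0` holds the adjacency matrix of `G` row by row, arrays `1` and `2` hold the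
characteristic vectors of `A` and `B`, and everything else is `0`. -/
noncomputable def instanceState {n : ℕ} (G : SimpleGraph (Fin n)) (s t : Fin n)
    (A B : Finset (Fin n)) : RAM.State where
  reg := fun i => if i = 0 then n else if i = 1 then (s : ℕ) else if i = 2 then (t : ℕ) else 0
  arr := fun a j =>
    if a = 0 then (if ∃ u v : Fin n, G.Adj u v ∧ j = (u : ℕ) * n + (v : ℕ) then 1 else 0)
    else if a = 1 then (if ∃ v ∈ A, j = (v : ℕ) then 1 else 0)
    else if a = 2 then (if ∃ v ∈ B, j = (v : ℕ) then 1 else 0)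
    else 0

/-- The memory state `m` says "yes" in register `0` and holds a token jumping reconfiguration
sequence from `A` to `B`: register `1` holds the number of jumps, and the `i`-th jump (counted
from `0`) moves the token on the vertex in cell `i` of array `3` to the vertex in cell `i` of
array `4`. -/
def AnswersYesWithWitness {n : ℕ} (G : SimpleGraph (Fin n)) (s t : Fin n) (A B : Finset (Fin n))
    (m : RAM.State) : Prop :=
  m.reg 0 = 1 ∧ ∃ S : ℕ → Finset (Fin n), IsJumpSequence G s t A B (m.reg 1) S ∧
    ∀ i < m.reg 1, ∃ v u : Fin n,
      m.arr 3 i = (v : ℕ) ∧ m.arr 4 i = (u : ℕ) ∧ IsTokenJump (S i) v u (S (i + 1))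

/-- The memory state `m` says "no" in register `0`. -/
def AnswersNo (m : RAM.State) : Prop := m.reg 0 = 0

/-! For a minimum separator S let R(S) (`reachSet`) be the vertex set of the component of s in G −
S. Minimality gives N(R(S)) = S, so R(S) determines S, and submodularity of |N(·)| makes N(R(S) ∪
R(S')) a minimum separator whenever S and S' are. A jump is upward if the vacated vertex ends up on
the side of s. Upward jumps strictly enlarge R, so an ascent is stuck after fewer than n of them.

The key is `IsStuck.reachSet_subset_of_jump`: if M is stuck, no jump between minimum separators
leaves the family of all S with R(S) ⊆ R(M). Let A ascend to a stuck M and B to a stuck N. If A can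
be reconfigured into B, then R(N) ⊆ R(M) and, by symmetry, equality holds, so M = N
(`JumpReconfigurable.stuck_eq`). Conversely, if M = N, the ascent from A followed by the reversed
ascent from B is the required sequence. The program computes both ascents and compares their ends;
it is verified by Hoare-style rules with step bounds (`Halts`). -/

/-! ### Source sides of separators and submodularity -/

section Separators

set_option linter.unusedSectionVars false

variable {V : Type*} [Fintype V] [DecidableEq V]

open scoped Classical in
/-- The vertices reachable from `s` by walks whose later vertices avoid `S`. -/
noncomputable def reachSet (G : SimpleGraph V) (s : V) (S : Finset V) : Finset V :=
  Finset.univ.filter fun y => Relation.ReflTransGen (fun x y => G.Adj x y ∧ y ∉ S) s y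

open scoped Classical in
/-- The vertices outside `X` with a neighbour in `X`. -/
noncomputable def openNbhd (G : SimpleGraph V) (X : Finset V) : Finset V :=
  Finset.univ.filter fun y => y ∉ X ∧ ∃ x ∈ X, G.Adj x y

variable {G : SimpleGraph V} {s t : V} {S S' M A B X Y : Finset V} {u v x y : V}

theorem mem_reachSet :
    y ∈ reachSet G s S ↔ Relation.ReflTransGen (fun x y => G.Adj x y ∧ y ∉ S) s y := by
  simp [reachSet]

theorem mem_openNbhd : y ∈ openNbhd G X ↔ y ∉ X ∧ ∃ x ∈ X, G.Adj x y := by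
  simp [openNbhd]

theorem self_mem_reachSet : s ∈ reachSet G s S := mem_reachSet.2 .refl

theorem mem_reachSet_of_adj (hx : x ∈ reachSet G s S) (h : G.Adj x y) (hy : y ∉ S) :
    y ∈ reachSet G s S :=
  mem_reachSet.2 ((mem_reachSet.1 hx).tail ⟨h, hy⟩)

theorem reachSet_subset_of_closed (hs : s ∈ X)
    (hX : ∀ x ∈ X, ∀ y, G.Adj x y → y ∉ S → y ∈ X) : reachSet G s S ⊆ X := by
  intro y hy
  induction mem_reachSet.1 hy with
  | refl => exact hs
  | tail h₁ h₂ ih => exact hX _ (ih (mem_reachSet.2 h₁)) _ h₂.1 h₂.2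

theorem disjoint_reachSet (hs : s ∉ S) : Disjoint (reachSet G s S) S := by
  rw [Finset.disjoint_left]
  intro y hy
  rcases Relation.ReflTransGen.cases_tail (mem_reachSet.1 hy) with h | ⟨z, _, h⟩
  · exact h ▸ hs
  · exact h.2

/-- A walk inside the source side of S never meets S', so it survives the deletion of S'. Inclusions
between source sides are thereby reduced to disjointness. -/
theorem reachSet_mono (h : Disjoint (reachSet G s S) S') : reachSet G s S ⊆ reachSet G s S' := by
  intro y hy
  induction mem_reachSet.1 hy with
  | refl => exact self_mem_reachSet
  | tail h₁ h₂ ih =>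
    exact mem_reachSet_of_adj (ih (mem_reachSet.2 h₁)) h₂.1 (Finset.disjoint_left.1 h hy)

theorem openNbhd_reachSet_subset : openNbhd G (reachSet G s S) ⊆ S := by
  intro y hy
  obtain ⟨h, x, hx, hxy⟩ := mem_openNbhd.1 hy
  by_contra hS
  exact h (mem_reachSet_of_adj hx hxy hS)

theorem disjoint_openNbhd : Disjoint X (openNbhd G X) :=
  Finset.disjoint_right.2 fun _ h => (mem_openNbhd.1 h).1

theorem mem_reachSet_iff_reachable (hs : s ∉ S) (hy : y ∉ S) :
    y ∈ reachSet G s S ↔ (G.induce ((S : Set V)ᶜ)).Reachable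
      ⟨s, by simpa using hs⟩ ⟨y, by simpa using hy⟩ := by
  constructor
  · intro h
    induction mem_reachSet.1 h with
    | refl => exact .refl _
    | @tail b c h₁ h₂ ih =>
      have hb := mem_reachSet.2 h₁
      have hb' := Finset.disjoint_left.1 (disjoint_reachSet hs) hb
      refine (ih hb' hb).trans (SimpleGraph.Adj.reachable ?_)
      simpa using h₂.1
  · rintro ⟨w⟩
    suffices ∀ a b : ((S : Set V)ᶜ : Set V), (G.induce ((S : Set V)ᶜ)).Walk a b →
        a.1 ∈ reachSet G s S → b.1 ∈ reachSet G s S from this _ _ w self_mem_reachSet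
    intro a b w
    induction w with
    | nil => exact id
    | @cons a b c h w ih =>
      intro ha
      exact ih (mem_reachSet_of_adj ha (by simpa using h)
        (by simpa only [Set.mem_compl_iff, Finset.mem_coe] using b.2))

theorem isSeparator_iff : IsSeparator G s t S ↔ s ∉ S ∧ t ∉ S ∧ t ∉ reachSet G s S := by
  constructor
  · rintro ⟨hs, ht, h⟩
    have hs' : s ∉ S := by simpa using hs
    have ht' : t ∉ S := by simpa using ht
    exact ⟨hs', ht', fun hR => h ((mem_reachSet_iff_reachable hs' ht').1 hR)⟩
  · rintro ⟨hs, ht, h⟩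
    exact ⟨by simpa using hs, by simpa using ht,
      fun hR => h ((mem_reachSet_iff_reachable hs ht).2 hR)⟩

theorem isSeparator_openNbhd (hs : s ∈ X) (ht : t ∉ X) (ht' : t ∉ openNbhd G X) :
    IsSeparator G s t (openNbhd G X) := by
  refine isSeparator_iff.2 ⟨fun h => (mem_openNbhd.1 h).1 hs, ht', fun h => ht ?_⟩
  refine reachSet_subset_of_closed hs (fun x hx y hxy hy => ?_) h
  by_contra hyX
  exact hy (mem_openNbhd.2 ⟨hyX, x, hx, hxy⟩)

/-- Both the union and the intersection of the two neighbourhoods on the left are contained in the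
union and the intersection, respectively, of those on the right. -/
theorem card_openNbhd_union_add_inter_le :
    (openNbhd G (X ∪ Y)).card + (openNbhd G (X ∩ Y)).card ≤
      (openNbhd G X).card + (openNbhd G Y).card := by
  rw [← Finset.card_union_add_card_inter, ← Finset.card_union_add_card_inter (openNbhd G X)]
  refine add_le_add (Finset.card_le_card fun y => ?_) (Finset.card_le_card fun y => ?_) <;>
  · simp only [Finset.mem_union, Finset.mem_inter, mem_openNbhd]
    grind

/-- The neighbourhood of the source side is contained in S and is already a separator, so minimality
leaves no room for a proper inclusion. -/
theorem IsMinSeparator.openNbhd_reachSet (h : IsMinSeparator G s t S) :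
    openNbhd G (reachSet G s S) = S := by
  obtain ⟨-, ht, hR⟩ := isSeparator_iff.1 h.1
  exact Finset.eq_of_subset_of_card_le openNbhd_reachSet_subset
    (h.2 _ (isSeparator_openNbhd self_mem_reachSet hR fun h => ht (openNbhd_reachSet_subset h)))

theorem IsMinSeparator.of_card_eq (h : IsMinSeparator G s t S) (h' : IsSeparator G s t S')
    (hc : S'.card ≤ S.card) : IsMinSeparator G s t S' :=
  ⟨h', fun T hT => hc.trans (h.2 T hT)⟩

theorem openNbhd_union_subset :
    openNbhd G (X ∪ Y) ⊆ openNbhd G X ∪ openNbhd G Y := by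
  intro y
  simp only [Finset.mem_union, mem_openNbhd]
  grind

theorem isSeparator_openNbhd_union (h : IsSeparator G s t S) (h' : IsSeparator G s t S') :
    IsSeparator G s t (openNbhd G (reachSet G s S ∪ reachSet G s S')) := by
  obtain ⟨-, ht, hR⟩ := isSeparator_iff.1 h
  obtain ⟨-, ht', hR'⟩ := isSeparator_iff.1 h'
  refine isSeparator_openNbhd (Finset.mem_union_left _ self_mem_reachSet)
    (by simp [hR, hR']) fun hN => ?_
  rcases Finset.mem_union.1 (openNbhd_union_subset hN) with h | h
  · exact ht (openNbhd_reachSet_subset h)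
  · exact ht' (openNbhd_reachSet_subset h)

/-- Uncrossing: the neighbourhood of the intersection is a separator too, hence not smaller than the
minimum, and submodularity bounds the one of the union. -/
theorem IsMinSeparator.openNbhd_union (h : IsMinSeparator G s t S)
    (h' : IsMinSeparator G s t S') :
    IsMinSeparator G s t (openNbhd G (reachSet G s S ∪ reachSet G s S')) := by
  refine h.of_card_eq (isSeparator_openNbhd_union h.1 h'.1) ?_
  obtain ⟨-, ht, hR⟩ := isSeparator_iff.1 h.1
  have hi : IsSeparator G s t (openNbhd G (reachSet G s S ∩ reachSet G s S')) := by
    refine isSeparator_openNbhd (by simp [self_mem_reachSet]) (by simp [hR]) fun hN => ?_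
    obtain ⟨-, x, hx, hxt⟩ := mem_openNbhd.1 hN
    exact ht (openNbhd_reachSet_subset (mem_openNbhd.2
      ⟨hR, x, (Finset.mem_inter.1 hx).1, hxt⟩))
  have h₁ := h'.2 _ hi
  have h₂ := card_openNbhd_union_add_inter_le (G := G) (X := reachSet G s S)
    (Y := reachSet G s S')
  rw [h.openNbhd_reachSet, h'.openNbhd_reachSet] at h₂
  omega

theorem IsTokenJump.card_eq (h : IsTokenJump S v u S') : S'.card = S.card := by
  obtain ⟨hv, hu, rfl⟩ := h
  rw [Finset.card_union_of_disjoint (by simp [hu]), Finset.card_sdiff_of_subset (by simpa)]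
  have := Finset.card_pos.2 ⟨v, hv⟩
  simp
  omega

theorem IsTokenJump.symm (h : IsTokenJump S v u S') : IsTokenJump S' u v S := by
  obtain ⟨hv, hu, rfl⟩ := h
  refine ⟨by simp, by simp; rintro rfl; exact hu hv, ?_⟩
  ext x
  simp only [Finset.mem_union, Finset.mem_sdiff, Finset.mem_singleton]
  grind

/-! ### Upward jumps and stuck separators -/

/-- A token jump to a separator that leaves the vacated vertex on the side of `s`. -/
def IsUpJump (G : SimpleGraph V) (s t : V) (S : Finset V) (v u : V) (S' : Finset V) : Prop :=
  IsTokenJump S v u S' ∧ IsSeparator G s t S' ∧ v ∈ reachSet G s S'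

theorem IsUpJump.isMinSeparator (h : IsUpJump G s t S v u S') (hS : IsMinSeparator G s t S) :
    IsMinSeparator G s t S' :=
  hS.of_card_eq h.2.1 h.1.card_eq.le

/-- The vertex v witnesses strictness. Inclusion could fail only if u were in R(S); then R(S) ∪
R(S') would contain both u and v, and its neighbourhood would be a separator inside S \ {v}, which
is too small. -/
theorem IsUpJump.reachSet_ssubset (h : IsUpJump G s t S v u S') (hS : IsMinSeparator G s t S) :
    reachSet G s S ⊂ reachSet G s S' := by
  obtain ⟨⟨hv, hu, rfl⟩, hsep, hvR⟩ := h
  have hd := disjoint_reachSet (G := G) (isSeparator_iff.1 hS.1).1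
  refine Finset.ssubset_iff_of_subset (reachSet_mono ?_) |>.2
    ⟨v, hvR, Finset.disjoint_right.1 hd hv⟩
  refine Finset.disjoint_union_right.2 ⟨hd.mono_right Finset.sdiff_subset, ?_⟩
  rw [Finset.disjoint_singleton_right]
  intro huR
  have hsub : openNbhd G (reachSet G s S ∪ reachSet G s ((S \ {v}) ∪ {u})) ⊆ S \ {v} := by
    intro y hy
    have hy' := (mem_openNbhd.1 hy).1
    have h₁ := openNbhd_union_subset hy
    rw [Finset.mem_union, not_or] at hy'
    rcases Finset.mem_union.1 h₁ with h₁ | h₁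
    · refine Finset.mem_sdiff.2 ⟨openNbhd_reachSet_subset h₁, ?_⟩
      rw [Finset.mem_singleton]
      rintro rfl
      exact hy'.2 hvR
    · rcases Finset.mem_union.1 (openNbhd_reachSet_subset h₁) with h₂ | h₂
      · exact h₂
      · rw [Finset.mem_singleton] at h₂
        exact absurd (h₂ ▸ huR) hy'.1
  have h₁ := hS.2 _ (isSeparator_openNbhd_union hS.1 hsep)
  have h₂ := Finset.card_le_card hsub
  rw [Finset.card_sdiff_of_subset (by simpa)] at h₂
  have := Finset.card_pos.2 ⟨v, hv⟩
  rw [Finset.card_singleton] at h₂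
  omega

/-- No upward jump starts at `M`. -/
def IsStuck (G : SimpleGraph V) (s t : V) (M : Finset V) : Prop :=
  ∀ v u S', ¬ IsUpJump G s t M v u S'

/-- Uncross M with S' to get N. A vertex of S' other than u lies in S = N(R(S)), so it has a
neighbour in R(S) ⊆ R(M); if it is in N, it is outside R(M) and hence in M. Thus N \ M ⊆ {u}. As |N|
= |M|, either N = M, which gives the inclusion, or N arises from M by a jump to u, which is upward
and contradicts stuckness. -/
theorem IsStuck.reachSet_subset_of_jump (hM : IsMinSeparator G s t M) (hst : IsStuck G s t M)
    (hS : IsMinSeparator G s t S) (hS' : IsMinSeparator G s t S') (hj : IsTokenJump S v u S')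
    (h : reachSet G s S ⊆ reachSet G s M) : reachSet G s S' ⊆ reachSet G s M := by
  set N := openNbhd G (reachSet G s M ∪ reachSet G s S') with hN
  have hNmin : IsMinSeparator G s t N := hM.openNbhd_union hS'
  have hdis : Disjoint (reachSet G s M ∪ reachSet G s S') N := disjoint_openNbhd
  obtain ⟨hd₁, hd₂⟩ := Finset.disjoint_union_left.1 hdis
  have hsub : ∀ y ∈ N, y ∉ M → y = u := by
    intro y hy hyM
    by_contra hyu
    rcases Finset.mem_union.1 (openNbhd_union_subset hy) with h₁ | h₁
    · exact hyM (openNbhd_reachSet_subset h₁)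
    · have h₂ := openNbhd_reachSet_subset h₁
      rw [hj.2.2] at h₂
      have hyS : y ∈ S := by simp [hyu] at h₂; exact h₂.1
      rw [← hS.openNbhd_reachSet] at hyS
      obtain ⟨-, x, hx, hxy⟩ := mem_openNbhd.1 hyS
      exact hyM (openNbhd_reachSet_subset (mem_openNbhd.2
        ⟨Finset.disjoint_right.1 hd₁ hy, x, h hx, hxy⟩))
  have hcard : N.card = M.card := le_antisymm (hNmin.2 _ hM.1) (hM.2 _ hNmin.1)
  by_cases hNM : N ⊆ M
  · have : N = M := Finset.eq_of_subset_of_card_le hNM hcard.ge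
    rw [← this]
    exact reachSet_mono hd₂
  obtain ⟨y, hyN, hyM⟩ := Finset.not_subset.1 hNM
  obtain rfl := hsub y hyN hyM
  obtain ⟨w, hwM, hwN⟩ := Finset.not_subset.1 fun hMN =>
    hNM (Finset.eq_of_subset_of_card_le hMN hcard.le).ge
  refine absurd ⟨⟨hwM, hyM, ?_⟩, hNmin.1, ?_⟩ (hst w y N)
  · refine Finset.eq_of_subset_of_card_le (fun z hz => ?_) ?_
    · by_cases hzM : z ∈ M
      · simp only [Finset.mem_union, Finset.mem_sdiff, Finset.mem_singleton]
        exact .inl ⟨hzM, fun e => hwN (e ▸ hz)⟩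
      · simp [hsub z hz hzM]
    · exact (IsTokenJump.card_eq ⟨hwM, hyM, rfl⟩).trans hcard.symm |>.le
  · have hwX : w ∈ reachSet G s M ∪ reachSet G s S' := by
      by_contra hw
      have hw' := hwM
      rw [← hM.openNbhd_reachSet] at hw'
      obtain ⟨-, x, hx, hxw⟩ := mem_openNbhd.1 hw'
      exact hwN (mem_openNbhd.2 ⟨hw, x, Finset.mem_union_left _ hx, hxw⟩)
    exact Finset.union_subset (reachSet_mono hd₁) (reachSet_mono hd₂) hwX

theorem IsStuck.reachSet_subset (hM : IsMinSeparator G s t M) (hst : IsStuck G s t M)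
    (hA : reachSet G s A ⊆ reachSet G s M) (h : JumpReconfigurable G s t A B) :
    reachSet G s B ⊆ reachSet G s M := by
  obtain ⟨l, S, rfl, rfl, hmin, hjump⟩ := h
  suffices ∀ i ≤ l, reachSet G s (S i) ⊆ reachSet G s M from this l le_rfl
  intro i
  induction i with
  | zero => exact fun _ => hA
  | succ i ih =>
    intro hi
    obtain ⟨v, u, hj⟩ := hjump i hi
    exact hst.reachSet_subset_of_jump hM (hmin i (by omega)) (hmin _ hi) hj (ih (by omega))

/-! ### Recorded jump sequences and the criterion for reconfigurability -/

/-- `S` is reached from `A` by `l` token jumps between minimum separators, the `i`-th of which goes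
from vertex `f i` to vertex `g i`. -/
def JumpPath (val : V → ℕ) (G : SimpleGraph V) (s t : V) (f g : ℕ → ℕ) (A B : Finset V)
    (l : ℕ) : Prop :=
  ∃ S : ℕ → Finset V, IsJumpSequence G s t A B l S ∧
    ∀ i < l, ∃ v u : V, f i = val v ∧ g i = val u ∧ IsTokenJump (S i) v u (S (i + 1))

variable {val : V → ℕ} {f g f' g' : ℕ → ℕ} {l : ℕ}

theorem JumpPath.congr (h : JumpPath val G s t f g A B l) (hf : ∀ i < l, f' i = f i)
    (hg : ∀ i < l, g' i = g i) : JumpPath val G s t f' g' A B l := by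
  obtain ⟨S, hS, h⟩ := h
  refine ⟨S, hS, fun i hi => ?_⟩
  rw [hf i hi, hg i hi]
  exact h i hi

theorem JumpPath.isMinSeparator (h : JumpPath val G s t f g A B l) : IsMinSeparator G s t B := by
  obtain ⟨S, ⟨-, rfl, h, -⟩, -⟩ := h
  exact h l le_rfl

theorem JumpPath.reconfigurable (h : JumpPath val G s t f g A B l) :
    JumpReconfigurable G s t A B := by
  obtain ⟨S, hS, -⟩ := h
  exact ⟨l, S, hS⟩

theorem JumpPath.nil (hA : IsMinSeparator G s t A) : JumpPath val G s t f g A A 0 :=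
  ⟨fun _ => A, ⟨rfl, rfl, fun _ _ => hA, by simp⟩, by simp⟩

theorem JumpPath.snoc (h : JumpPath val G s t f g A S l) (hS' : IsMinSeparator G s t S')
    (hj : IsTokenJump S v u S') (hf : f l = val v) (hg : g l = val u) :
    JumpPath val G s t f g A S' (l + 1) := by
  obtain ⟨T, ⟨h₀, h₁, h₂, -⟩, h₄⟩ := h
  have key : ∀ i < l + 1, ∃ v u : V, f i = val v ∧ g i = val u ∧
      IsTokenJump ((fun i => if i ≤ l then T i else S') i) v u
        ((fun i => if i ≤ l then T i else S') (i + 1)) := by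
    intro i hi
    rcases Nat.lt_succ_iff_lt_or_eq.1 hi with hi | rfl
    · simpa [hi.le, Nat.succ_le_of_lt hi] using h₄ i hi
    · exact ⟨v, u, hf, hg, by simpa [h₁] using hj⟩
  refine ⟨fun i => if i ≤ l then T i else S', ⟨by simpa using h₀, by simp, fun i _ => ?_,
    fun i hi => ?_⟩, key⟩
  · by_cases hi : i ≤ l
    · simpa [hi] using h₂ i hi
    · simpa [hi] using hS'
  · obtain ⟨v, u, -, -, h⟩ := key i hi
    exact ⟨v, u, h⟩

theorem JumpPath.unsnoc (h : JumpPath val G s t f g A S' (l + 1)) :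
    ∃ S v u, JumpPath val G s t f g A S l ∧ f l = val v ∧ g l = val u ∧ IsTokenJump S v u S' := by
  obtain ⟨T, ⟨h₀, rfl, h₂, h₃⟩, h₄⟩ := h
  obtain ⟨v, u, hf, hg, hj⟩ := h₄ l (by omega)
  exact ⟨T l, v, u, ⟨T, ⟨h₀, rfl, fun i hi => h₂ i (by omega), fun i hi => h₃ i (by omega)⟩,
    fun i hi => h₄ i (by omega)⟩, hf, hg, hj⟩

theorem JumpReconfigurable.symm (h : JumpReconfigurable G s t A B) :
    JumpReconfigurable G s t B A := by
  obtain ⟨l, S, rfl, rfl, h₁, h₂⟩ := h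
  refine ⟨l, fun i => S (l - i), by simp, by simp, fun i _ => h₁ _ (by omega), fun i hi => ?_⟩
  obtain ⟨v, u, h⟩ := h₂ (l - (i + 1)) (by omega)
  rw [show l - (i + 1) + 1 = l - i by omega] at h
  exact ⟨u, v, h.symm⟩

/-- If greedy ascents from `A` and `B` end in `M` and `N`, then `A` can be reconfigured into `B`
only if `M = N`. -/
theorem JumpReconfigurable.stuck_eq {N : Finset V} (h : JumpReconfigurable G s t A B)
    (hM : IsMinSeparator G s t M) (hMst : IsStuck G s t M) (hAM : JumpReconfigurable G s t A M)
    (hAM' : reachSet G s A ⊆ reachSet G s M)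
    (hN : IsMinSeparator G s t N) (hNst : IsStuck G s t N) (hBN : JumpReconfigurable G s t B N)
    (hBN' : reachSet G s B ⊆ reachSet G s N) : M = N := by
  -- From A all of B and N stay below M, since N is reached from B; the same argument with the roles
  -- exchanged puts M below N.
  have h₁ := hMst.reachSet_subset hM (hMst.reachSet_subset hM hAM' h) hBN
  have h₂ := hNst.reachSet_subset hN (hNst.reachSet_subset hN hBN' h.symm) hAM
  rw [← hM.openNbhd_reachSet, ← hN.openNbhd_reachSet, h₂.antisymm h₁]

/-! ### Reachability in boundedly many steps -/

/-- The vertices reachable from `s` by at most `k` steps whose later vertices avoid `S`. -/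
def reachIn (G : SimpleGraph V) (s : V) (S : Finset V) : ℕ → Set V
  | 0 => {s}
  | k + 1 => {y | y ∈ reachIn G s S k ∨ ∃ x ∈ reachIn G s S k, G.Adj x y ∧ y ∉ S}

theorem reachIn_mono {k l : ℕ} (h : k ≤ l) : reachIn G s S k ⊆ reachIn G s S l := by
  induction h with
  | refl => exact subset_rfl
  | step _ ih => exact fun y hy => .inl (ih hy)

/-- A path has fewer edges than there are vertices, so n rounds of marking suffice. The walk is
taken from y back to s, so that its first edge is the last step of `reachIn`. -/
theorem reachSet_subset_reachIn (hs : s ∉ S) :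
    (reachSet G s S : Set V) ⊆ reachIn G s S (Fintype.card V) := by
  intro y hy
  have hyS := Finset.disjoint_left.1 (disjoint_reachSet hs) (Finset.mem_coe.1 hy)
  obtain ⟨w⟩ := ((mem_reachSet_iff_reachable hs hyS).1 hy).symm
  suffices ∀ a b : ((S : Set V)ᶜ : Set V), ∀ w : (G.induce ((S : Set V)ᶜ)).Walk a b,
      b.1 = s → a.1 ∈ reachIn G s S w.length by
    classical
    refine reachIn_mono ?_ (this _ _ w.bypass rfl)
    have := w.bypass_isPath.length_lt
    exact this.le.trans (Fintype.card_subtype_le _)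
  intro a b w hb
  induction w with
  | nil => exact hb
  | @cons a b c h w ih =>
    refine .inr ⟨b.1, ih hb, ?_, by simpa only [Set.mem_compl_iff, Finset.mem_coe] using a.2⟩
    simpa using h.symm

end Separators

/-! ### Program rules with time bounds -/

namespace RAM

/-- Started in `m`, the program `P` halts after at most `b` steps in a state that satisfies `Q`. -/
def Halts (P : Program) (m : State) (b : ℕ) (Q : State → Prop) : Prop :=
  ∃ (T : ℕ) (m' : State), Run P m T m' ∧ T ≤ b ∧ Q m'

variable {P P₁ P₂ : Program} {m : State} {b b₁ b₂ : ℕ} {Q Q' R : State → Prop} {e e' : Expr}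

theorem Halts.mono (h : Halts P m b₁ Q) (hb : b₁ ≤ b₂) (hQ : ∀ m', Q m' → Q' m') :
    Halts P m b₂ Q' := by
  obtain ⟨T, m', hr, hT, hq⟩ := h
  exact ⟨T, m', hr, hT.trans hb, hQ _ hq⟩

theorem Halts.post (h : Halts P m b Q) (hQ : ∀ m', Q m' → Q' m') : Halts P m b Q' :=
  h.mono le_rfl hQ

theorem Halts.skip (h : Q m) : Halts .skip m 1 Q := ⟨_, _, .skip m, le_rfl, h⟩

theorem Halts.assign {i : ℕ} (h : Q (m.setReg i (e.eval m))) :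
    Halts (.assign i e) m (e.cost + 1) Q := ⟨_, _, .assign m i e, le_rfl, h⟩

theorem Halts.store {a : ℕ} (h : Q (m.setArr a (e.eval m) (e'.eval m))) :
    Halts (.store a e e') m (e.cost + e'.cost + 1) Q := ⟨_, _, .store m a e e', le_rfl, h⟩

theorem Halts.seq (h₁ : Halts P₁ m b₁ R) (h₂ : ∀ m', R m' → Halts P₂ m' b₂ Q) :
    Halts (.seq P₁ P₂) m (b₁ + b₂) Q := by
  obtain ⟨T₁, m₁, hr₁, hT₁, hR⟩ := h₁
  obtain ⟨T₂, m₂, hr₂, hT₂, hQ⟩ := h₂ _ hR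
  exact ⟨_, _, .seq hr₁ hr₂, add_le_add hT₁ hT₂, hQ⟩

/-- The sum of the two bounds, in place of their maximum, keeps all cost bounds semiring
expressions, which can be read as polynomials. -/
theorem Halts.branch (h₁ : e.eval m ≠ 0 → Halts P₁ m b₁ Q) (h₂ : e.eval m = 0 → Halts P₂ m b₂ Q) :
    Halts (.branch e P₁ P₂) m (e.cost + 1 + (b₁ + b₂)) Q := by
  by_cases h : e.eval m = 0
  · obtain ⟨T, m', hr, hT, hQ⟩ := h₂ h
    exact ⟨_, _, .branch_false h hr, by omega, hQ⟩
  · obtain ⟨T, m', hr, hT, hQ⟩ := h₁ h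
    exact ⟨_, _, .branch_true h hr, by omega, hQ⟩

/-- A loop whose variant `f` decreases in each round. -/
theorem Halts.loop (I : ℕ → State → Prop) (b : ℕ)
    (h₁ : ∀ k m, I k m → e.eval m ≠ 0 →
      ∃ k', k = k' + 1 ∧ Halts P m b (I k'))
    (k : ℕ) (hm : I k m) :
    Halts (.loop e P) m (k * (e.cost + 1 + b) + (e.cost + 1))
      fun m' => (∃ k', I k' m') ∧ e.eval m' = 0 := by
  induction k generalizing m with
  | zero =>
    by_cases h : e.eval m = 0
    · exact ⟨_, _, .loop_false h, by omega, ⟨0, hm⟩, h⟩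
    · obtain ⟨k', h', -⟩ := h₁ _ _ hm h
      omega
  | succ k ih =>
    by_cases h : e.eval m = 0
    · exact ⟨_, _, .loop_false h, by omega, ⟨_, hm⟩, h⟩
    · obtain ⟨k', h', T₁, m₁, hr₁, hT₁, hI⟩ := h₁ _ _ hm h
      obtain rfl : k = k' := by omega
      obtain ⟨T₂, m₂, hr₂, hT₂, hQ⟩ := ih hI
      refine ⟨_, _, .loop_true h hr₁ hr₂, ?_, hQ⟩
      rw [add_mul, one_mul]
      omega

/-- Run `P` with the register `c` counting from `0` up to, excluding, the value of register `0`. -/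
def Program.for (c : ℕ) (P : Program) : Program :=
  .seq (.assign c (.const 0))
    (.loop (.sub (.reg 0) (.reg c)) (.seq P (.assign c (.add (.reg c) (.const 1)))))

/-- A bound for the running time of a counting loop with `n` rounds of at most `b` steps. -/
def forCost {R : Type*} [Semiring R] (n b : R) : R := n * (b + 8) + 6

@[simp] theorem State.setReg_reg (m : State) (i x j : ℕ) :
    (m.setReg i x).reg j = if j = i then x else m.reg j := by
  simp [State.setReg, Function.update_apply]

@[simp] theorem State.setReg_arr (m : State) (i x : ℕ) : (m.setReg i x).arr = m.arr := rfl

@[simp] theorem State.setArr_reg (m : State) (a j x : ℕ) : (m.setArr a j x).reg = m.reg := rfl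

@[simp] theorem State.setArr_arr (m : State) (a j x a' j' : ℕ) :
    (m.setArr a j x).arr a' j' = if a' = a ∧ j' = j then x else m.arr a' j' := by
  simp only [State.setArr, Function.update_apply]
  split_ifs <;> simp_all

/-- The loop variant is the number k of remaining rounds, with counter value n − k. The invariant is
required after the increment, so that it may mention the counter. -/
theorem Halts.for {c n b : ℕ} (I : ℕ → State → Prop) (hc : c ≠ 0) (hn : m.reg 0 = n)
    (h₀ : I 0 (m.setReg c 0))
    (h : ∀ i < n, ∀ m', m'.reg 0 = n → m'.reg c = i → I i m' →
      Halts P m' b fun m'' => m''.reg 0 = n ∧ m''.reg c = i ∧ I (i + 1) (m''.setReg c (i + 1))) :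
    Halts (.for c P) m (forCost n b) (I n) := by
  have h₁ := Halts.loop (e := .sub (.reg 0) (.reg c))
    (P := .seq P (.assign c (.add (.reg c) (.const 1)))) (m := m.setReg c 0)
    (fun k m' => k ≤ n ∧ m'.reg 0 = n ∧ m'.reg c = n - k ∧ I (n - k) m') (b + 4) ?_ n ?_
  · refine (Halts.seq (.assign (Q := fun m' => m' = m.setReg c 0) rfl) ?_).mono (b₁ := _)
      (?_ : (1 + 1) + (n * (3 + 1 + (b + 4)) + (3 + 1)) ≤ _) ?_ (Q := I n)
    · rintro _ rfl
      refine h₁.post ?_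
      rintro m' ⟨⟨k, hk, h0, hc', hI⟩, he⟩
      simp only [Expr.eval, h0, hc'] at he
      rwa [show n - k = n by omega] at hI
    · simp only [forCost]
      apply le_of_eq
      push_cast
      ring
    · exact fun _ h => h
  · rintro k m' ⟨hk, h0, hc', hI⟩ he
    simp only [Expr.eval, h0, hc'] at he
    obtain ⟨k, rfl⟩ := Nat.exists_eq_succ_of_ne_zero (show k ≠ 0 by omega)
    refine ⟨k, rfl, (h _ (by omega) m' h0 hc' hI).seq (b₂ := 4) ?_⟩
    rintro m'' ⟨h0, hc'', hI⟩
    refine Halts.assign ⟨by omega, ?_, ?_, ?_⟩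
    · simp [hc.symm, h0]
    · simp [Expr.eval, hc'']
      omega
    · simp only [Expr.eval, hc'']
      rwa [show n - (k + 1) + 1 = n - k by omega] at hI ⊢
  · refine ⟨le_rfl, ?_, by simp, by simpa using h₀⟩
    simp [hc.symm, hn]

end RAM

/-! ### Memory encoding and the reachability program -/

namespace RAM

variable {n : ℕ} {G : SimpleGraph (Fin n)} {s t : Fin n} {S S' A B : Finset (Fin n)}
  {m m' : State}

/-- The state `m` holds the size and the two terminals in registers `0`, `1`, `2` and the adjacency
matrix in array `0`. -/
structure HoldsGraph (G : SimpleGraph (Fin n)) (s t : Fin n) (m : State) : Prop where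
  size : m.reg 0 = n
  source : m.reg 1 = s
  sink : m.reg 2 = t
  adj : ∀ u v : Fin n, m.arr 0 (u * n + v) ≠ 0 ↔ G.Adj u v

/-- The array `f` holds the characteristic vector of `S`. -/
def HoldsSet (f : ℕ → ℕ) (S : Finset (Fin n)) : Prop :=
  ∀ v : Fin n, f v = if v ∈ S then 1 else 0

theorem HoldsGraph.congr (h : HoldsGraph G s t m) (h₁ : ∀ i < 3, m'.reg i = m.reg i)
    (h₂ : m'.arr 0 = m.arr 0) : HoldsGraph G s t m' :=
  ⟨(h₁ 0 (by simp)).trans h.size, (h₁ 1 (by simp)).trans h.source,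
    (h₁ 2 (by simp)).trans h.sink, by rw [h₂]; exact h.adj⟩

theorem index_inj {a b : ℕ} {x y : Fin n} (hb : b < n) (h : (x : ℕ) * n + y = a * n + b) :
    (x : ℕ) = a ∧ (y : ℕ) = b := by
  have hn : 0 < n := by omega
  refine ⟨?_, ?_⟩
  · have := congrArg (· / n) h
    simpa [Nat.mul_add_div, mul_comm _ n, Nat.div_eq_of_lt y.2, Nat.div_eq_of_lt hb, hn] using this
  · have := congrArg (· % n) h
    simpa [Nat.mul_add_mod', Nat.mod_eq_of_lt y.2, Nat.mod_eq_of_lt hb] using this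

theorem index_lt (x y : Fin n) : (x : ℕ) * n + y < n * n := by
  have h : ((x : ℕ) + 1) * n ≤ n * n := Nat.mul_le_mul_right _ x.2
  have := y.2
  rw [add_mul, one_mul] at h
  omega

/-- Mark in array `5` the vertices that are reachable from the source outside of array `a`. -/
def Program.reach (a : ℕ) : Program :=
  .seq (.for 10 (.store 5 (.reg 10) (.const 0)))
    (.seq (.store 5 (.reg 1) (.const 1))
      -- Register 12 runs through the matrix index x * n + y by increments, since the machine has no
      -- multiplication.
      (.for 13 (.seq (.assign 12 (.const 0)) (.for 10 (.for 11
        (.seq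
          -- Truncated subtraction encodes a conjunction: 1 minus a sum is nonzero exactly when
          -- every summand is 0.
          (.branch (.sub (.const 1) (.add (.add (.sub (.const 1) (.load 5 (.reg 10)))
            (.sub (.const 1) (.load 0 (.reg 12)))) (.load a (.reg 11))))
            (.store 5 (.reg 11) (.const 1)) .skip)
          (.assign 12 (.add (.reg 12) (.const 1)))))))))

/-- A bound for the running time of `Program.reach`. -/
def reachCost {R : Type*} [Semiring R] (n : R) : R :=
  forCost n 3 + (3 + forCost n (2 + forCost n (forCost n 23)))

/-- What `Program.reach` leaves unchanged. -/
def ReachFrame (m m' : State) : Prop :=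
  (∀ i < 10, m'.reg i = m.reg i) ∧ ∀ b ≠ 5, m'.arr b = m.arr b

theorem ReachFrame.setReg (h : ReachFrame m m') {i x : ℕ} (hi : 10 ≤ i) :
    ReachFrame m (m'.setReg i x) :=
  ⟨fun j hj => by rw [State.setReg_reg, if_neg (by omega), h.1 j hj], h.2⟩

theorem ReachFrame.setArr (h : ReachFrame m m') {i x : ℕ} : ReachFrame m (m'.setArr 5 i x) :=
  ⟨h.1, fun b hb => by ext j; simp [hb, h.2 b hb]⟩

/-- The invariant of `Program.reach`: round `k` has looked at the first `idx` pairs of vertices. -/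
structure ReachInv (G : SimpleGraph (Fin n)) (s : Fin n) (S : Finset (Fin n)) (m : State)
    (k idx : ℕ) (m' : State) : Prop where
  frame : ReachFrame m m'
  -- The bound is the full reachable set and not `reachIn` at k, because a mark can propagate
  -- further within the round that sets it.
  sound : ∀ y : Fin n, m'.arr 5 y ≠ 0 → y ∈ reachSet G s S
  complete : ∀ y : Fin n, y ∈ reachIn G s S k → m'.arr 5 y ≠ 0
  partly : ∀ x y : Fin n, (x : ℕ) * n + y < idx → x ∈ reachIn G s S k → G.Adj x y → y ∉ S →
    m'.arr 5 y ≠ 0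

theorem ReachInv.setReg {k idx : ℕ} (h : ReachInv G s S m k idx m') {i x : ℕ} (hi : 10 ≤ i) :
    ReachInv G s S m k idx (m'.setReg i x) :=
  ⟨h.frame.setReg hi, h.sound, h.complete, h.partly⟩

theorem ReachInv.mark {k idx : ℕ} (h : ReachInv G s S m k idx m') {y : Fin n}
    (hy : y ∈ reachSet G s S) : ReachInv G s S m k idx (m'.setArr 5 y 1) := by
  refine ⟨h.frame.setArr, fun z => ?_, fun z hz => ?_, fun x z h₁ h₂ h₃ h₄ => ?_⟩
  · by_cases hz : z = y
    · exact fun _ => hz ▸ hy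
    · simpa [Fin.val_inj, hz] using h.sound z
  · by_cases hzy : z = y
    · simp [hzy]
    · simpa [Fin.val_inj, hzy] using h.complete z hz
  · by_cases hzy : z = y
    · simp [hzy]
    · simpa [Fin.val_inj, hzy] using h.partly x z h₁ h₂ h₃ h₄

theorem ReachInv.next_round {k : ℕ} (h : ReachInv G s S m k (n * n) m') :
    ReachInv G s S m (k + 1) 0 m' := by
  refine ⟨h.frame, h.sound, ?_, by simp⟩
  rintro y (hy | ⟨x, hx, hxy, hyS⟩)
  · exact h.complete y hy
  · exact h.partly x y (index_lt x y) hx hxy hyS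

theorem ReachInv.next_pair {k : ℕ} {x y : Fin n} (h : ReachInv G s S m k (x * n + y) m')
    (hy : x ∈ reachIn G s S k → G.Adj x y → y ∉ S → m'.arr 5 y ≠ 0) :
    ReachInv G s S m k (x * n + y + 1) m' := by
  refine ⟨h.frame, h.sound, h.complete, fun x' y' hlt => ?_⟩
  rcases Nat.lt_succ_iff_lt_or_eq.1 hlt with hlt | heq
  · exact h.partly x' y' hlt
  · obtain ⟨h₁, h₂⟩ := index_inj y.2 heq
    rwa [Fin.ext h₁, Fin.ext h₂]

theorem halts_reach {a : ℕ} (ha : a ≠ 5) (hm : HoldsGraph G s t m) (hS : HoldsSet (m.arr a) S)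
    (hs : s ∉ S) : Halts (.reach a) m (reachCost n) fun m' =>
      ReachFrame m m' ∧ ∀ v : Fin n, m'.arr 5 v ≠ 0 ↔ v ∈ reachSet G s S := by
  have hrefl : ReachFrame m m := ⟨fun _ _ => rfl, fun _ _ => rfl⟩
  refine .seq (R := fun m' => ReachFrame m m' ∧ ∀ v : Fin n, m'.arr 5 v = 0) ?_ ?_
  · refine (Halts.for (fun i m' => ReachFrame m m' ∧ ∀ v : Fin n, (v : ℕ) < i → m'.arr 5 v = 0)
      (by simp) hm.size ⟨hrefl.setReg le_rfl, by simp⟩ ?_).post fun m' h => ⟨h.1, fun v => h.2 v v.2⟩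
    intro i hi m₁ h0 hc ⟨hf, hz⟩
    refine .store ⟨h0, hc, (ReachFrame.setArr hf).setReg le_rfl, fun v hv => ?_⟩
    simp only [State.setReg_arr, State.setArr_arr, Expr.eval, hc, true_and]
    split_ifs with hvi
    · rfl
    · exact hz v (by omega)
  rintro m₁ ⟨hf, hz⟩
  refine .seq (R := ReachInv G s S m 0 0) (.store ?_) fun m₂ h₂ => ?_
  · simp only [Expr.eval, hf.1 1 (by simp), hm.source]
    refine ⟨hf.setArr, fun y hy => ?_, ?_, by simp⟩
    · by_cases hys : y = s
      · exact hys ▸ self_mem_reachSet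
      · simp [Fin.val_inj, hys, hz] at hy
    · rintro y rfl
      simp
  refine (Halts.for (ReachInv G s S m · 0) (by simp) (by rw [h₂.frame.1 0 (by simp), hm.size])
    (h₂.setReg (by simp)) ?_).post fun m' h => ⟨h.frame, fun v => ⟨h.sound v, fun hv =>
      h.complete v (by simpa using reachSet_subset_reachIn hs (Finset.mem_coe.2 hv))⟩⟩
  intro k hk m₃ h0 hc h₃
  refine .seq (b₁ := 2) (R := fun m' => m'.reg 13 = k ∧ m'.reg 12 = 0 ∧ ReachInv G s S m k 0 m')
    (.assign ⟨by simpa using hc, by simp [Expr.eval], h₃.setReg (by simp)⟩)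
    fun m₄ ⟨hc₄, hi₄, h₄⟩ => ?_
  refine (Halts.for (fun x m' => m'.reg 13 = k ∧ m'.reg 12 = x * n ∧ ReachInv G s S m k (x * n) m')
    (by simp) (by rw [h₄.frame.1 0 (by simp), hm.size])
    ⟨by simpa using hc₄, by simpa using hi₄, by simpa using h₄.setReg le_rfl⟩ ?_).post
    fun m' h => ⟨by rw [h.2.2.frame.1 0 (by simp), hm.size], h.1,
      (ReachInv.next_round h.2.2).setReg (by simp)⟩
  intro x hx m₅ h0 hx₅ ⟨hc₅, hi₅, h₅⟩
  refine (Halts.for (fun y m' => m'.reg 13 = k ∧ m'.reg 10 = x ∧ m'.reg 12 = x * n + y ∧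
      ReachInv G s S m k (x * n + y) m') (by simp) h0
    ⟨by simpa using hc₅, by simpa using hx₅, by simpa using hi₅, by simpa using h₅.setReg (by simp)⟩
    ?_).post fun m' h => ?_
  swap
  · obtain ⟨h₁, h₂, h₃, h₄⟩ := h
    refine ⟨by rw [h₄.frame.1 0 (by simp), hm.size], h₂, by simpa using h₁, ?_, ?_⟩
    · simp [h₃, add_mul]
    · rw [add_mul, one_mul]
      exact h₄.setReg le_rfl
  intro y hy m₆ h0 hy₆ ⟨hc₆, hx₆, hi₆, h₆⟩
  lift x to Fin n using hx
  lift y to Fin n using hy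
  refine .seq (b₁ := 19) (b₂ := 4) (R := fun m' => m'.reg 13 = k ∧ m'.reg 10 = x ∧ m'.reg 11 = y ∧
    m'.reg 12 = x * n + y ∧ ReachInv G s S m k (x * n + y + 1) m') ?_ fun m₇ h₇ => ?_
  swap
  · obtain ⟨h₁, h₂, h₃, h₄, h₅⟩ := h₇
    refine .assign ⟨?_, ?_, ?_, ?_, ?_, ?_⟩
    · simp [h₅.frame.1 0 (by simp), hm.size]
    · simpa using h₃
    · simpa using h₁
    · simpa using h₂
    · simp [Expr.eval, h₄, add_assoc]
    · exact (h₅.setReg (by simp)).setReg (by simp)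
  have hadj := hm.adj x y
  have hSy := hS y
  rw [← h₆.frame.2 0 (by simp)] at hadj
  rw [← h₆.frame.2 a ha] at hSy
  have key : Expr.eval m₆ (.sub (.const 1) (.add (.add (.sub (.const 1) (.load 5 (.reg 10)))
      (.sub (.const 1) (.load 0 (.reg 12)))) (.load a (.reg 11)))) ≠ 0 ↔
      m₆.arr 5 x ≠ 0 ∧ G.Adj x y ∧ y ∉ S := by
    rw [← hadj]
    simp only [Expr.eval, hx₆, hy₆, hi₆, hSy]
    by_cases h : y ∈ S
    · simp [h]
    · simp only [h, if_false, not_false_eq_true, and_true]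
      omega
  refine (Halts.branch (b₁ := 3) (b₂ := 1) (fun h => ?_) fun h => ?_).mono (b₁ := 14 + 1 + (3 + 1)) (by simp) fun _ h => h
  · obtain ⟨h₁, h₂, h₃⟩ := key.1 h
    refine .store ⟨hc₆, hx₆, hy₆, hi₆, ?_⟩
    simp only [Expr.eval, hy₆]
    refine ReachInv.next_pair (h₆.mark ?_) fun _ _ _ => by simp
    exact mem_reachSet_of_adj (h₆.sound x h₁) h₂ h₃
  · refine .skip ⟨hc₆, hx₆, hy₆, hi₆, ReachInv.next_pair h₆ ?_⟩
    intro h₁ h₂ h₃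
    exact absurd h (key.2 ⟨h₆.complete x h₁, h₂, h₃⟩)

end RAM

/-! ### The greedy ascent program -/

namespace RAM

variable {n : ℕ} {G : SimpleGraph (Fin n)} {s t : Fin n} {S S' A B : Finset (Fin n)}
  {m m' : State}

/-- Ascend greedily from the separator in array `a`: in each of `n` passes, all upward jumps that
are found are made. The jumps are recorded in arrays `f`, `g`, their number in register `c`. -/
def Program.ascend (a f g c : ℕ) : Program :=
  .seq (.assign c (.const 0)) (.for 7 (.for 8 (.for 9
    (.branch (.sub (.const 1) (.add (.add (.add (.sub (.const 1) (.load a (.reg 8)))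
        (.load a (.reg 9)))
        -- The two truncated differences add up to |u − s|, so this summand vanishes exactly when u
        -- ≠ s; likewise for t below.
        (.sub (.const 1) (.add (.sub (.reg 9) (.reg 1)) (.sub (.reg 1) (.reg 9)))))
        (.sub (.const 1) (.add (.sub (.reg 9) (.reg 2)) (.sub (.reg 2) (.reg 9))))))
      -- The jump is made tentatively, then kept if v is marked and t is not, and undone otherwise.
      (.seq (.store a (.reg 8) (.const 0)) (.seq (.store a (.reg 9) (.const 1))
        (.seq (.reach a)
          (.branch (.sub (.const 1) (.add (.sub (.const 1) (.load 5 (.reg 8))) (.load 5 (.reg 2))))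
            (.seq (.store f (.reg c) (.reg 8)) (.seq (.store g (.reg c) (.reg 9))
              (.assign c (.add (.reg c) (.const 1)))))
            (.seq (.store a (.reg 8) (.const 1)) (.store a (.reg 9) (.const 0)))))))
      .skip))))

/-- A bound for the running time of `Program.ascend`. -/
def ascendCost {R : Type*} [Semiring R] (n : R) : R :=
  2 + forCost n (forCost n (forCost n (30 + (3 + (3 + (reachCost n + 26)) + 1))))

/-- The separator `S` is the result of `l` upward jumps from `A`, and pass `p` has looked at the
first `idx` pairs of vertices. -/
structure Ascent (G : SimpleGraph (Fin n)) (s t : Fin n) (A : Finset (Fin n)) (p idx : ℕ)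
    (f g : ℕ → ℕ) (l : ℕ) (S : Finset (Fin n)) : Prop where
  path : JumpPath Fin.val G s t f g A S l
  subset : reachSet G s A ⊆ reachSet G s S
  lt_card : l < (reachSet G s S).card
  -- Either no jump is left, or the current pass has already contributed one, or every pair examined
  -- in this pass has failed for the unchanged S.
  progress : IsStuck G s t S ∨ p + 1 ≤ l ∨ p ≤ l ∧
    ∀ v u : Fin n, (v : ℕ) * n + u < idx → ∀ S', ¬ IsUpJump G s t S v u S'

namespace Ascent

variable {p idx l : ℕ} {f g f' g' : ℕ → ℕ} {v u : Fin n}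

theorem start (hA : IsMinSeparator G s t A) : Ascent G s t A 0 0 f g 0 A :=
  ⟨.nil hA, subset_rfl, Finset.card_pos.2 ⟨s, self_mem_reachSet⟩, .inr (.inr ⟨le_rfl, by simp⟩)⟩

theorem lt_size (h : Ascent G s t A p idx f g l S) : l < n :=
  h.lt_card.trans_le ((Finset.card_le_univ _).trans_eq (Fintype.card_fin n))

theorem next_pass (h : Ascent G s t A p (n * n) f g l S) : Ascent G s t A (p + 1) 0 f g l S := by
  refine ⟨h.path, h.subset, h.lt_card, ?_⟩
  rcases h.progress with h | h | ⟨-, h⟩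
  · exact .inl h
  · exact .inr (.inr ⟨h, by simp⟩)
  · exact .inl fun v u => h v u (index_lt v u)

/-- A pass that does not end stuck contributes at least one jump, so n such passes would need n
jumps, but l < |R(S)| ≤ n. -/
theorem isStuck (h : Ascent G s t A n 0 f g l S) : IsStuck G s t S := by
  have := h.lt_size
  rcases h.progress with h | h | ⟨h, -⟩
  · exact h
  · omega
  · omega

theorem reject (h : Ascent G s t A p (v * n + u) f g l S) (hu : ∀ S', ¬ IsUpJump G s t S v u S') :
    Ascent G s t A p (v * n + u + 1) f g l S := by
  refine ⟨h.path, h.subset, h.lt_card, h.progress.imp_right (.imp_right (.imp_right ?_))⟩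
  intro h v' u' hlt
  rcases Nat.lt_succ_iff_lt_or_eq.1 hlt with hlt | heq
  · exact h v' u' hlt
  · obtain ⟨h₁, h₂⟩ := index_inj u.2 heq
    rwa [Fin.ext h₁, Fin.ext h₂]

/-- Once the pass has made a jump, its second alternative of `progress` holds for good. Pairs
rejected for the old separator need no new examination, whence the arbitrary `idx'`. -/
theorem accept (h : Ascent G s t A p idx f g l S) (hu : IsUpJump G s t S v u S')
    (hf : ∀ i, f' i = if i = l then (v : ℕ) else f i)
    (hg : ∀ i, g' i = if i = l then (u : ℕ) else g i) (idx' : ℕ) :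
    Ascent G s t A p idx' f' g' (l + 1) S' := by
  have hS := h.path.isMinSeparator
  have hR := hu.reachSet_ssubset hS
  refine ⟨(h.path.congr (fun i hi => ?_) fun i hi => ?_).snoc (hu.isMinSeparator hS) hu.1 ?_ ?_,
    h.subset.trans hR.1, ?_, ?_⟩
  · rw [hf, if_neg hi.ne]
  · rw [hg, if_neg hi.ne]
  · simp [hf]
  · simp [hg]
  · exact lt_of_le_of_lt h.lt_card (Finset.card_lt_card hR)
  · rcases h.progress with h | h | ⟨h, -⟩
    · exact absurd hu (h _ _ _)
    · exact .inr (.inl (h.trans (Nat.le_succ _)))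
    · exact .inr (.inl (Nat.succ_le_succ h))

end Ascent

/-- The invariant of `Program.ascend`. -/
structure AscendInv (G : SimpleGraph (Fin n)) (s t : Fin n) (A : Finset (Fin n)) (a f g c : ℕ)
    (m : State) (p idx : ℕ) (m' : State) : Prop where
  reg : ∀ i < 7, i ≠ c → m'.reg i = m.reg i
  arr : ∀ b, b ≠ 5 → b ≠ a → b ≠ f → b ≠ g → m'.arr b = m.arr b
  ascent : ∃ S, HoldsSet (m'.arr a) S ∧ Ascent G s t A p idx (m'.arr f) (m'.arr g) (m'.reg c) S

theorem AscendInv.setReg {a f g c p idx i x : ℕ} (hi : 7 ≤ i) (hc : c < 7)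
    (h : AscendInv G s t A a f g c m p idx m') :
    AscendInv G s t A a f g c m p idx (m'.setReg i x) := by
  refine ⟨fun j hj hjc => ?_, h.arr, ?_⟩
  · rw [State.setReg_reg, if_neg (by omega), h.reg j hj hjc]
  · simpa [show c ≠ i by omega] using h.ascent

theorem HoldsSet.jump {a : ℕ} {v u : Fin n} (h : HoldsSet (m.arr a) S) :
    HoldsSet (((m.setArr a v 0).setArr a u 1).arr a) ((S \ {v}) ∪ {u}) := by
  intro x
  have := h x
  simp only [State.setArr_arr, true_and, Fin.val_inj, Finset.mem_union, Finset.mem_sdiff,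
    Finset.mem_singleton, this]
  grind

theorem HoldsSet.undo_jump {a : ℕ} {v u : Fin n} (h : HoldsSet (m.arr a) ((S \ {v}) ∪ {u}))
    (hv : v ∈ S) (hu : u ∉ S) : HoldsSet (((m.setArr a v 1).setArr a u 0).arr a) S := by
  intro x
  have := h x
  simp only [State.setArr_arr, true_and, Fin.val_inj, this, Finset.mem_union, Finset.mem_sdiff,
    Finset.mem_singleton]
  grind

/-- Distinctness of the arrays prevents writes from interfering; the bounds on c keep the jump
counter apart from n, s, t and from the loop counters. -/
theorem halts_ascend_step {a f g c p : ℕ} (hd : [0, 5, a, f, g].Nodup) (hc₃ : 3 ≤ c) (hc₇ : c < 7)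
    (hm : HoldsGraph G s t m) {v u : Fin n} {m₁ : State}
    (h : AscendInv G s t A a f g c m p (v * n + u) m₁) (hp : m₁.reg 7 = p) (hv : m₁.reg 8 = v)
    (hu : m₁.reg 9 = u) :
    Halts (.branch (.sub (.const 1) (.add (.add (.add (.sub (.const 1) (.load a (.reg 8)))
        (.load a (.reg 9)))
        (.sub (.const 1) (.add (.sub (.reg 9) (.reg 1)) (.sub (.reg 1) (.reg 9)))))
        (.sub (.const 1) (.add (.sub (.reg 9) (.reg 2)) (.sub (.reg 2) (.reg 9))))))
      (.seq (.store a (.reg 8) (.const 0)) (.seq (.store a (.reg 9) (.const 1))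
        (.seq (.reach a)
          (.branch (.sub (.const 1) (.add (.sub (.const 1) (.load 5 (.reg 8))) (.load 5 (.reg 2))))
            (.seq (.store f (.reg c) (.reg 8)) (.seq (.store g (.reg c) (.reg 9))
              (.assign c (.add (.reg c) (.const 1)))))
            (.seq (.store a (.reg 8) (.const 1)) (.store a (.reg 9) (.const 0)))))))
      .skip) m₁ (30 + (3 + (3 + (reachCost n + 26)) + 1)) fun m' =>
      m'.reg 7 = p ∧ m'.reg 8 = v ∧ m'.reg 9 = u ∧
        AscendInv G s t A a f g c m p (v * n + u + 1) m' := by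
  simp only [List.nodup_cons, List.mem_cons, List.not_mem_nil, or_false, not_or,
    List.nodup_nil, and_true, not_false_eq_true] at hd
  obtain ⟨⟨h05, h0a, h0f, h0g⟩, ⟨h5a, h5f, h5g⟩, ⟨haf, hag⟩, hfg⟩ := hd
  obtain ⟨hreg, harr, S, hS, hasc⟩ := h
  have hm₁ : HoldsGraph G s t m₁ :=
    hm.congr (fun i hi => hreg i (by omega) (by omega)) (harr 0 h05 h0a h0f h0g)
  have hsS := (isSeparator_iff.1 hasc.path.isMinSeparator.1).1
  have key : Expr.eval m₁ (.sub (.const 1) (.add (.add (.add (.sub (.const 1) (.load a (.reg 8)))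
        (.load a (.reg 9)))
        (.sub (.const 1) (.add (.sub (.reg 9) (.reg 1)) (.sub (.reg 1) (.reg 9)))))
        (.sub (.const 1) (.add (.sub (.reg 9) (.reg 2)) (.sub (.reg 2) (.reg 9)))))) ≠ 0 ↔
      v ∈ S ∧ u ∉ S ∧ u ≠ s ∧ u ≠ t := by
    simp only [Expr.eval, hv, hu, hm₁.source, hm₁.sink, hS v, hS u, ne_eq, ← Fin.val_inj]
    by_cases h₁ : v ∈ S
    · by_cases h₂ : u ∈ S
      · simp [h₁, h₂, add_assoc, Nat.sub_eq_zero_of_le]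
      · simp only [h₁, h₂, if_true, if_false, not_false_eq_true, true_and]
        omega
    · simp [h₁, add_assoc, Nat.sub_eq_zero_of_le]
  refine .branch (fun h => ?_) fun h => .skip ⟨hp, hv, hu, hreg, harr, S, hS, hasc.reject ?_⟩
  swap
  · rintro S' ⟨⟨hvS, huS, rfl⟩, hsep, -⟩
    obtain ⟨h₁, h₂, -⟩ := isSeparator_iff.1 hsep
    exact absurd h (key.2 ⟨hvS, huS, fun e => h₁ (by simp [e]), fun e => h₂ (by simp [e])⟩)
  obtain ⟨hvS, huS, hus, hut⟩ := key.1 h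
  refine .seq (b₁ := 3) (R := fun m' => m' = m₁.setArr a v 0) (.store (by simp [Expr.eval, hv])) ?_
  rintro _ rfl
  refine .seq (b₁ := 3) (R := fun m' => m' = (m₁.setArr a v 0).setArr a u 1)
    (.store (by simp [Expr.eval, hu])) ?_
  rintro _ rfl
  have hs' : s ∉ (S \ {v}) ∪ {u} := by simp [hsS, hus.symm]
  have ht' : t ∉ (S \ {v}) ∪ {u} := by
    simp [(isSeparator_iff.1 hasc.path.isMinSeparator.1).2.1, hut.symm]
  refine .seq (halts_reach (s := s) (t := t) (G := G) (Ne.symm h5a) (hm₁.congr (by simp) ?_) hS.jump hs')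
    ?_
  · ext j
    simp [h0a]
  rintro m₂ ⟨⟨hfr, hfa⟩, hR⟩
  have hv₂ : m₂.reg 8 = v := by simpa [hv] using hfr 8 (by simp)
  have hu₂ : m₂.reg 9 = u := by simpa [hu] using hfr 9 (by simp)
  have ht₂ : m₂.reg 2 = t := by simpa [hm₁.sink] using hfr 2 (by simp)
  have hp₂ : m₂.reg 7 = p := by simpa [hp] using hfr 7 (by simp)
  have hc₂ : m₂.reg c = m₁.reg c := by simpa using hfr c (by omega)
  have hf₂ : m₂.arr f = m₁.arr f := by ext j; simp [hfa f (Ne.symm h5f), Ne.symm haf]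
  have hg₂ : m₂.arr g = m₁.arr g := by ext j; simp [hfa g (Ne.symm h5g), Ne.symm hag]
  have hS₂ : HoldsSet (m₂.arr a) ((S \ {v}) ∪ {u}) := by
    rw [hfa a (Ne.symm h5a)]
    exact hS.jump
  have hreg₂ : ∀ i < 7, i ≠ c → m₂.reg i = m.reg i := fun i hi hic => by
    rw [hfr i (by omega)]
    simpa using hreg i hi hic
  have harr₂ : ∀ b, b ≠ 5 → b ≠ a → b ≠ f → b ≠ g → m₂.arr b = m.arr b := by
    intro b h₁ h₂ h₃ h₄
    rw [← harr b h₁ h₂ h₃ h₄]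
    ext j
    simp [hfa b h₁, h₂]
  -- The new set avoids s and t, so the two marks alone decide whether it separates and leaves v on
  -- the source side.
  have key₂ : Expr.eval m₂ (.sub (.const 1) (.add (.sub (.const 1) (.load 5 (.reg 8)))
      (.load 5 (.reg 2)))) ≠ 0 ↔ IsUpJump G s t S v u ((S \ {v}) ∪ {u}) := by
    simp only [Expr.eval, hv₂, ht₂, IsUpJump, isSeparator_iff, hs', ht', ← hR]
    simp only [IsTokenJump, hvS, huS, not_false_eq_true, true_and, not_not]
    omega
  refine .branch (b₁ := 3 + (3 + 4)) (b₂ := 3 + 3) (fun hup => ?_) fun hup => ?_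
  · refine .seq (R := fun m' => m' = m₂.setArr f (m₁.reg c) v)
      (.store (by simp [Expr.eval, hv₂, hc₂])) ?_
    rintro _ rfl
    refine .seq (R := fun m' => m' = (m₂.setArr f (m₁.reg c) v).setArr g (m₁.reg c) u)
      (.store (by simp [Expr.eval, hu₂, hc₂])) ?_
    rintro _ rfl
    refine .assign ⟨?_, ?_, ?_, fun i hi hic => ?_, fun b h₁ h₂ h₃ h₄ => ?_, (S \ {v}) ∪ {u},
      fun x => ?_, ?_⟩
    · simpa [show 7 ≠ c by omega] using hp₂
    · simpa [show 8 ≠ c by omega] using hv₂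
    · simpa [show 9 ≠ c by omega] using hu₂
    · simpa [hic] using hreg₂ i hi hic
    · ext j
      simp [h₃, h₄, harr₂ b h₁ h₂ h₃ h₄]
    · simpa [haf, hag] using hS₂ x
    · simp only [Expr.eval, State.setReg_reg, if_true, State.setArr_reg, hc₂]
      refine hasc.accept (key₂.1 hup) (fun i => ?_) (fun i => ?_) _
      · simp [hfg, hf₂]
      · simp [Ne.symm hfg, hg₂]
  · refine .seq (R := fun m' => m' = m₂.setArr a v 1) (.store (by simp [Expr.eval, hv₂])) ?_
    rintro _ rfl
    refine .store ?_
    simp only [Expr.eval, State.setArr_reg, hu₂]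
    refine ⟨hp₂, hv₂, trivial, hreg₂, fun b h₁ h₂ h₃ h₄ => ?_, S, hS₂.undo_jump hvS huS, ?_⟩
    · ext j
      simp [h₂, harr₂ b h₁ h₂ h₃ h₄]
    · have hf₃ : ((m₂.setArr a v 1).setArr a u 0).arr f = m₁.arr f := by
        ext j; simp [Ne.symm haf, hf₂]
      have hg₃ : ((m₂.setArr a v 1).setArr a u 0).arr g = m₁.arr g := by
        ext j; simp [Ne.symm hag, hg₂]
      rw [hf₃, hg₃, State.setArr_reg, State.setArr_reg, hc₂]
      refine hasc.reject ?_
      rintro S' hj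
      obtain rfl := hj.1.2.2
      exact absurd hup (key₂.2 hj)

theorem halts_ascend {a f g c : ℕ} (hd : [0, 5, a, f, g].Nodup) (hc₃ : 3 ≤ c) (hc₇ : c < 7)
    (hm : HoldsGraph G s t m) (hA : HoldsSet (m.arr a) A) (hmin : IsMinSeparator G s t A) :
    Halts (.ascend a f g c) m (ascendCost n) (AscendInv G s t A a f g c m n 0) := by
  have size : ∀ {p idx m'}, AscendInv G s t A a f g c m p idx m' → m'.reg 0 = n := fun h => by
    rw [h.reg 0 (by omega) (by omega), hm.size]
  refine .seq (R := AscendInv G s t A a f g c m 0 0) (.assign ⟨?_, fun _ _ _ _ _ => rfl, A, hA, ?_⟩)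
    fun m₁ h₁ => ?_
  · intro i _ hic
    simp [hic]
  · simpa [Expr.eval] using Ascent.start hmin
  refine .for (AscendInv G s t A a f g c m · 0) (by simp) (size h₁) (h₁.setReg le_rfl hc₇) ?_
  intro p hp m₂ h0 hp₂ h₂
  refine (Halts.for (fun v m' => m'.reg 7 = p ∧ AscendInv G s t A a f g c m p (v * n) m')
    (by simp) (size h₂) ⟨by simpa using hp₂, by simpa using h₂.setReg (by simp) hc₇⟩ ?_).post
    fun m' h => ⟨size h.2, h.1, ?_⟩
  swap
  · obtain ⟨h₁, h₂, S, h₃, h₄⟩ := h.2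
    exact AscendInv.setReg le_rfl hc₇ ⟨h₁, h₂, S, h₃, h₄.next_pass⟩
  intro v hv m₃ h0 hv₃ ⟨hp₃, h₃⟩
  refine (Halts.for (fun u m' => m'.reg 7 = p ∧ m'.reg 8 = v ∧
      AscendInv G s t A a f g c m p (v * n + u) m') (by simp) (size h₃)
    ⟨by simpa using hp₃, by simpa using hv₃, by simpa using h₃.setReg (by simp) hc₇⟩ ?_).post
    fun m' h => ⟨size h.2.2, h.2.1, by simpa using h.1, ?_⟩
  swap
  · rw [add_mul, one_mul]
    exact h.2.2.setReg (by simp) hc₇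
  intro u hu m₄ h0 hu₄ ⟨hp₄, hv₄, h₄⟩
  lift v to Fin n using hv
  lift u to Fin n using hu
  refine (halts_ascend_step hd hc₃ hc₇ hm h₄ hp₄ hv₄ hu₄).post fun m' ⟨h₁, h₂, h₃, h₅⟩ =>
    ⟨size h₅, h₃, by simpa using h₁, by simpa using h₂, h₅.setReg (by simp) hc₇⟩

end RAM

/-! ### Joining the two ascents and the complete program -/

namespace RAM

variable {n : ℕ} {G : SimpleGraph (Fin n)} {s t : Fin n} {S S' A B : Finset (Fin n)}
  {m m' : State}

/-- Append the reverse of the jumps recorded in arrays `6`, `7` to those in arrays `3`, `4`. -/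
def Program.appendReverse : Program :=
  .loop (.reg 4) (.seq (.assign 4 (.sub (.reg 4) (.const 1)))
    (.seq (.store 3 (.reg 3) (.load 7 (.reg 4)))
      (.seq (.store 4 (.reg 3) (.load 6 (.reg 4))) (.assign 3 (.add (.reg 3) (.const 1))))))

/-- The invariant is a common endpoint X of the output from A and of the first k recorded jumps from
B. Each round takes the last of these and appends it with its ends exchanged, so X moves back along
the ascent until it is B at k = 0. -/
theorem halts_appendReverse (h₁ : JumpPath Fin.val G s t (m.arr 3) (m.arr 4) A S (m.reg 3))
    (h₂ : JumpPath Fin.val G s t (m.arr 6) (m.arr 7) B S (m.reg 4)) (hn : m.reg 4 ≤ n) :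
    Halts .appendReverse m (n * 18 + 2) fun m' =>
      JumpPath Fin.val G s t (m'.arr 3) (m'.arr 4) A B (m'.reg 3) := by
  refine (Halts.loop (fun k m' => m'.reg 4 = k ∧ ∃ X,
    JumpPath Fin.val G s t (m'.arr 3) (m'.arr 4) A X (m'.reg 3) ∧
    JumpPath Fin.val G s t (m'.arr 6) (m'.arr 7) B X k) 16 ?_ (m.reg 4) ⟨rfl, S, h₁, h₂⟩).mono
    (?_ : m.reg 4 * (1 + 1 + 16) + (1 + 1) ≤ _) ?_
  · rintro k m₁ ⟨hk, X, hA, hB⟩ he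
    simp only [Expr.eval, hk] at he
    obtain ⟨k, rfl⟩ := Nat.exists_eq_succ_of_ne_zero he
    refine ⟨k, rfl, ?_⟩
    obtain ⟨Y, v, u, hY, hv, hu, hj⟩ := hB.unsnoc
    refine .seq (b₁ := 4) (b₂ := 4 + (4 + 4)) (R := fun m' => m' = m₁.setReg 4 k)
      (.assign (by simp [Expr.eval, hk])) ?_
    rintro _ rfl
    refine .seq (R := fun m' => m' = (m₁.setReg 4 k).setArr 3 (m₁.reg 3) u)
      (.store (by simp [Expr.eval, hu])) ?_
    rintro _ rfl
    refine .seq (R := fun m' => m' =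
      ((m₁.setReg 4 k).setArr 3 (m₁.reg 3) u).setArr 4 (m₁.reg 3) v)
      (.store (by simp [Expr.eval, hv])) ?_
    rintro _ rfl
    refine .assign ⟨by simp, Y, ?_, hY.congr (by simp) (by simp)⟩
    simp only [Expr.eval, State.setReg_reg, State.setArr_reg, if_true]
    refine (hA.congr (fun i hi => ?_) fun i hi => ?_).snoc hY.isMinSeparator hj.symm
      (by simp) (by simp)
    · simp [hi.ne]
    · simp [hi.ne]
  · have := Nat.mul_le_mul_right 18 hn
    omega
  · rintro m' ⟨⟨k, hk, X, hA, hB⟩, he⟩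
    simp only [Expr.eval, hk] at he
    subst he
    obtain ⟨T, ⟨rfl, rfl, -⟩, -⟩ := hB
    exact hA

/-- Set register `5` to `0` if the arrays `1` and `2` differ below the size, and to `1` if not. -/
def Program.compare : Program :=
  .seq (.assign 5 (.const 1)) (.for 8 (.branch
    (.add (.sub (.load 1 (.reg 8)) (.load 2 (.reg 8)))
      (.sub (.load 2 (.reg 8)) (.load 1 (.reg 8))))
    (.assign 5 (.const 0)) .skip))

theorem halts_compare (hn : m.reg 0 = n) (hA : HoldsSet (m.arr 1) A) (hB : HoldsSet (m.arr 2) B) :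
    Halts .compare m (2 + forCost n 15) fun m' => m'.arr = m.arr ∧
      (∀ i < 5, m'.reg i = m.reg i) ∧ (m'.reg 5 ≠ 0 ↔ A = B) := by
  refine .seq (R := fun m' => m' = m.setReg 5 1) (.assign rfl) ?_
  rintro _ rfl
  refine (Halts.for (c := 8) (m := m.setReg 5 1) (n := n) (fun i m' => m'.arr = m.arr ∧ (∀ i < 5, m'.reg i = m.reg i) ∧
    (m'.reg 5 ≠ 0 ↔ ∀ v : Fin n, (v : ℕ) < i → (v ∈ A ↔ v ∈ B))) (by simp) (by simp [hn])
    ⟨rfl, fun i hi => ?_, by simp⟩ ?_).post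
    fun m' h => ⟨h.1, h.2.1, ?_⟩
  · simp [show i ≠ 8 by omega, show i ≠ 5 by omega]
  · intro i hi m₁ h0 hi₁ ⟨ha, hr, he⟩
    lift i to Fin n using hi
    have key : Expr.eval m₁ (.add (.sub (.load 1 (.reg 8)) (.load 2 (.reg 8)))
        (.sub (.load 2 (.reg 8)) (.load 1 (.reg 8)))) = 0 ↔ (i ∈ A ↔ i ∈ B) := by
      simp only [Expr.eval, hi₁, ha, hA i, hB i]
      by_cases h₁ : i ∈ A <;> by_cases h₂ : i ∈ B <;> simp [h₁, h₂]
    refine .branch (b₁ := 2) (b₂ := 1) (fun h => .assign ?_) fun h => .skip ?_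
    · refine ⟨by simpa using h0, by simpa using hi₁, ha, fun j hj => ?_, ?_⟩
      · simp [show j ≠ 8 by omega, show j ≠ 5 by omega, hr j hj]
      · simp only [State.setReg_reg, Expr.eval]
        refine iff_of_false (by simp) fun h' => h (key.2 (h' i (by omega)))
    · refine ⟨h0, hi₁, ha, fun j hj => ?_, ?_⟩
      · simp [show j ≠ 8 by omega, hr j hj]
      · rw [State.setReg_reg, if_neg (by simp), he]
        refine ⟨fun h' v hv => ?_, fun h' v hv => h' v (by omega)⟩
        rcases Nat.lt_succ_iff_lt_or_eq.1 hv with hv | hv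
        · exact h' v hv
        · rw [Fin.ext hv]
          exact key.1 h
  · rw [h.2.2, Finset.ext_iff]
    exact ⟨fun h v => h v v.2, fun h v _ => h v⟩

/-- Decide whether the separator in array `1` can be reconfigured into the one in array `2`. -/
def Program.reconfigure : Program :=
  .seq (.ascend 1 3 4 3) (.seq (.ascend 2 6 7 4) (.seq .compare
    (.branch (.reg 5)
      (.seq .appendReverse (.seq (.assign 1 (.reg 3)) (.assign 0 (.const 1))))
      (.assign 0 (.const 0)))))

/-- A bound for the running time of `Program.reconfigure`. -/
def reconfigureCost {R : Type*} [Semiring R] (n : R) : R :=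
  ascendCost n + (ascendCost n + ((2 + forCost n 15) + (2 + (((n * 18 + 2) + 4) + 2))))

/-- The bounds are defined over every semiring, so one expression serves as a polynomial and as its
values. -/
theorem eval_reconfigureCost :
    (reconfigureCost (Polynomial.X : Polynomial ℕ)).eval n = reconfigureCost n := by
  simp [reconfigureCost, ascendCost, reachCost, forCost]

theorem holdsGraph_instanceState : HoldsGraph G s t (instanceState G s t A B) := by
  refine ⟨rfl, rfl, rfl, fun u v => ?_⟩
  simp only [instanceState, if_true, ne_eq, ite_eq_right_iff, one_ne_zero, imp_false, not_not]
  refine ⟨?_, fun h => ⟨u, v, h, rfl⟩⟩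
  rintro ⟨x, y, h, he⟩
  obtain ⟨h₁, h₂⟩ := index_inj y.2 he
  rwa [Fin.ext h₁, Fin.ext h₂]

theorem holdsSet_instanceState_left : HoldsSet ((instanceState G s t A B).arr 1) A := by
  intro v
  simp [instanceState, Fin.val_inj]

theorem holdsSet_instanceState_right : HoldsSet ((instanceState G s t A B).arr 2) B := by
  intro v
  simp [instanceState, Fin.val_inj]

theorem halts_reconfigure (hm : HoldsGraph G s t m) (hA : HoldsSet (m.arr 1) A)
    (hB : HoldsSet (m.arr 2) B) (hAmin : IsMinSeparator G s t A) (hBmin : IsMinSeparator G s t B) :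
    Halts .reconfigure m (reconfigureCost n) fun m' =>
      (JumpReconfigurable G s t A B → AnswersYesWithWitness G s t A B m') ∧
        (¬ JumpReconfigurable G s t A B → AnswersNo m') := by
  refine .seq (halts_ascend (by decide) (by simp) (by simp) hm hA hAmin) ?_
  rintro m₁ ⟨hr₁, ha₁, M, hM, hAM⟩
  have hB₁ : HoldsSet (m₁.arr 2) B := by
    rwa [ha₁ 2 (by simp) (by simp) (by simp) (by simp)]
  have hm₁ : HoldsGraph G s t m₁ :=
    hm.congr (fun i hi => hr₁ i (by omega) (by omega)) (ha₁ 0 (by simp) (by simp) (by simp) (by simp))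
  refine .seq (halts_ascend (by decide) (by simp) (by simp) hm₁ hB₁ hBmin) ?_
  rintro m₂ ⟨hr₂, ha₂, N, hN, hBN⟩
  -- The second ascent uses other arrays and another counter, so the end and the record of the first
  -- are still in memory.
  rw [← ha₂ 1 (by simp) (by simp) (by simp) (by simp)] at hM
  rw [← ha₂ 3 (by simp) (by simp) (by simp) (by simp),
    ← ha₂ 4 (by simp) (by simp) (by simp) (by simp), ← hr₂ 3 (by simp) (by simp)] at hAM
  have hn₂ : m₂.reg 0 = n := by rw [hr₂ 0 (by simp) (by simp), hm₁.size]
  refine .seq (halts_compare hn₂ hM hN) ?_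
  rintro m₃ ⟨ha₃, hr₃, heq⟩
  rw [← ha₃, ← hr₃ 3 (by simp)] at hAM
  rw [← ha₃, ← hr₃ 4 (by simp)] at hBN
  refine .branch (fun h => ?_) fun h => .assign ?_
  · obtain rfl := heq.1 h
    refine (halts_appendReverse hAM.path hBN.path hBN.lt_size.le).seq (b₂ := 2 + 2) fun m₄ h₄ => ?_
    refine .seq (R := fun m' => m' = m₄.setReg 1 (m₄.reg 3)) (.assign rfl) ?_
    rintro _ rfl
    exact .assign ⟨fun _ => ⟨rfl, h₄⟩, fun hno => absurd h₄.reconfigurable hno⟩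
  · refine ⟨fun hyes => absurd h (heq.2 ?_), fun _ => rfl⟩
    exact hyes.stuck_eq hAM.path.isMinSeparator hAM.isStuck hAM.path.reconfigurable hAM.subset
      hBN.path.isMinSeparator hBN.isStuck hBN.path.reconfigurable hBN.subset

end RAM

/-- One fixed program, with a running time polynomial in the number `n` of vertices, decides for
all finite graphs `G`, vertices `s`, `t` and minimum `s`-`t`-separators `A`, `B` whether `A` can be
reconfigured into `B` by token jumps, and outputs a sequence of jumps when it can. -/
theorem mainTheorem6 :
    ∃ (P : RAM.Program) (p : Polynomial ℕ),
      ∀ (n : ℕ) (G : SimpleGraph (Fin n)) (s t : Fin n) (A B : Finset (Fin n)),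
        IsMinSeparator G s t A → IsMinSeparator G s t B →
          ∃ (T : ℕ) (m : RAM.State),
            RAM.Run P (instanceState G s t A B) T m ∧ T ≤ p.eval n ∧
              (JumpReconfigurable G s t A B → AnswersYesWithWitness G s t A B m) ∧
              (¬ JumpReconfigurable G s t A B → AnswersNo m) := by
  refine ⟨.reconfigure, RAM.reconfigureCost .X, fun n G s t A B hA hB => ?_⟩
  rw [RAM.eval_reconfigureCost]
  exact RAM.halts_reconfigure RAM.holdsGraph_instanceState RAM.holdsSet_instanceState_left
    RAM.holdsSet_instanceState_right hA hB
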